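/- Let $X$ be a Fréchet space (real or complex) which admits a continuous norm, and let $Y$ be a separable Fréchet space over the same field. Let $(p_l)_{l\ge 1}$ and $(q_l)_{l\ge 1}$ be non-decreasing sequences of seminorms defining the topologies of $X$ and $Y$, respectively. Let $\Lambda$ be a set and, for each $\lambda\in\Lambda$, let $(T_{k,\lambda})_{k\ge 0}$ be a sequence of continuous linear operators from $X$ to $Y$. A chain of $\Lambda$ is a sequence $(\Lambda_n)_{n\ge 1}$ of subsets of $\Lambda$ with $\Lambda_n\subseteq\Lambda_{n+1}$ for all $n\geq 1$ and $\bigcup_{n\ge 1}\Lambda_n=\Lambda$. Suppose that there exist chains $(\Lambda^j_n)_{n\ge 1}$ of $\Lambda$ $(j=0,1,2)$ such that: (i) for every $k,n\ge 1$, the family $\{T_{k,\lambda}\}_{\lambda\in\Lambda^0_n}$ is equicontinuous; (ii) for every $n\ge 1$, there exists a dense subset $X_{n,0}$ of $X$ such that for every $x\in X_{n,0}$, $T_{k,\lambda}x\to 0$ as $k\to\infty$, uniformly in $\lambda\in\Lambda^1_n$; (iii) for every $l,n\ge 1$, every $\varepsilon>0$, every $y\in Y$ and every integer $K_0\ge 0$,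 there exist $x\in X$ and an integer $K_1\ge K_0$ such that $p_l(x)<\varepsilon$ and such that for every $\lambda\in\Lambda^2_n$ there exists an integer $k\in[K_0,K_1]$ with $q_l(T_{k,\lambda}x-y)<\varepsilon$; (iv) there exists an infinite-dimensional closed subspace $M_0$ of $X$ such that for every $(\lambda,x)\in\Lambda\times M_0$, $T_{k,\lambda}x\to 0$ as $k\to\infty$. Then $\{(T_{k,\lambda})_{k\ge 0}\}_{\lambda\in\Lambda}$ has a common hypercyclic subspace, i.e. there is a closed infinite-dimensional subspace $M$ of $X$ such that for every $x\in M\setminus\{0\}$ and every $\lambda\in\Lambda$, the set $\{T_{k,\lambda}x : k\ge 0\}$ is dense in $Y$. -/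

import Mathlib

open Filter Topology

/-- `E`, with its given uniformity, is a Fréchet space over `𝕜`: the uniformity is the one of the
additive group, the space is Hausdorff and complete, and the topology is generated by a sequence of
seminorms. -/
structure IsFrechetSpace (𝕜 E : Type*) [RCLike 𝕜] [AddCommGroup E] [Module 𝕜 E]
    [UniformSpace E] : Prop where
  uniformAddGroup : IsUniformAddGroup E
  t2 : T2Space E
  complete : CompleteSpace E
  exists_seminorms : ∃ p : ℕ → Seminorm 𝕜 E, WithSeminorms p

/-- `p` is a non-decreasing sequence of seminorms which generates the topology of `E`. -/
structure IsDefiningSequence {𝕜 E : Type*} [RCLike 𝕜] [AddCommGroup E] [Module 𝕜 E]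
    [TopologicalSpace E] (p : ℕ → Seminorm 𝕜 E) : Prop where
  monotone : Monotone p
  withSeminorms : WithSeminorms p

/-- There is a continuous norm on `E`: a continuous seminorm that vanishes only at `0`. -/
def HasContinuousNorm (𝕜 E : Type*) [RCLike 𝕜] [AddCommGroup E] [Module 𝕜 E]
    [TopologicalSpace E] : Prop :=
  ∃ p : Seminorm 𝕜 E, Continuous p ∧ ∀ x, p x = 0 → x = 0

/-- `(L n)_{n ≥ 1}` is a chain of `Λ`: a non-decreasing sequence of subsets with union `Λ`
(the value `L 0` plays no role). -/
structure IsChainOf {Λ : Type*} (L : ℕ → Set Λ) : Prop where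
  mono : ∀ n ≥ 1, L n ⊆ L (n + 1)
  exhausts : ∀ lam : Λ, ∃ n ≥ 1, lam ∈ L n

/-- The family of sequences `(T k lam)_{k ≥ 0}`, `lam ∈ Λ`, has a common hypercyclic subspace: a
closed infinite-dimensional subspace `M` of `X` such that, for each non-zero `x` in `M` and
each `lam`, the orbit `{T k lam x : k ≥ 0}` is dense in `Y`. -/
def HasCommonHypercyclicSubspace {𝕜 X Y Λ : Type*} [RCLike 𝕜]
    [AddCommGroup X] [Module 𝕜 X] [TopologicalSpace X]
    [AddCommGroup Y] [Module 𝕜 Y] [TopologicalSpace Y]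
    (T : ℕ → Λ → X →L[𝕜] Y) : Prop :=
  ∃ M : Submodule 𝕜 X, IsClosed (M : Set X) ∧ ¬ FiniteDimensional 𝕜 M ∧
    ∀ x ∈ M, x ≠ 0 → ∀ lam : Λ, Dense (Set.range fun k : ℕ => T k lam x)

/-! Let `P` be a continuous norm on `X`. Shrink `M₀` to a separable closed infinite-dimensional
`M₁`, so that countably many functionals `φ n` bounded by `P` detect every nonzero vector of `M₁`.
The subspace sought is the image of `M₁` under `id + K`, where `K v = ∑ t, φ (n t) v • z t`. The `z
t` are so small that `P (K v) ≤ P v / 2`, hence `id + K` is a closed embedding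
(`WithSeminorms.isClosedEmbedding_id_add`).

By `exists_seq_approximating`, for each `lam ∈ A s` some `T k lam` with `k ≥ s` sends `z s` near `y
s` and every other `z t` near `0`. As `T k lam v → 0` on `M₀`, this gives `T k lam (v + K v) ≈ φ (n
s) v • y s`. Every pair of a functional and a member of a dense sequence occurs as `(φ (n s), y s)`
for arbitrarily large `s`, so orbits are dense.

The `z t` are limits of successive corrections (`exists_next_approximation`). Density (ii) moves the
earlier vectors so that their images die out uniformly; (iii) then adds a vector that acts in a
later, bounded window of times; equicontinuity (i) on that window tells how small all later
corrections must be. -/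

/-! ### Seminorm estimates and small perturbations of the identity. -/

section Seminorms

variable {𝕜 E : Type*} [RCLike 𝕜] [AddCommGroup E] [Module 𝕜 E]

/-- Hahn–Banach for a seminorm: every point has a norming functional. -/
theorem Seminorm.exists_norming_functional (P : Seminorm 𝕜 E) (x : E) :
    ∃ f : E →ₗ[𝕜] 𝕜, f x = (P x : 𝕜) ∧ ∀ y, ‖f y‖ ≤ P y := by
  let _ : SeminormedAddCommGroup E := P.toAddGroupSeminorm.toSeminormedAddCommGroup
  let _ : NormedSpace 𝕜 E := { norm_smul_le := fun a b ↦ le_of_eq (map_smul_eq_mul P a b) }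
  obtain ⟨g, hg, hgx⟩ := exists_dual_vector'' 𝕜 x
  refine ⟨g.toLinearMap, hgx, fun y => ?_⟩
  have := g.le_of_opNorm_le hg y
  rw [one_mul] at this
  exact this

/-- A seminorm that is continuous on a separable set has countably many functionals below it which
detect its zeros on that set. -/
theorem Seminorm.exists_seq_functional_ne_zero [TopologicalSpace E] [IsTopologicalAddGroup E]
    {P : Seminorm 𝕜 E} (hP : Continuous P) {S : Set E} (hS : TopologicalSpace.IsSeparable S) :
    ∃ φ : ℕ → E →ₗ[𝕜] 𝕜, (∀ n y, ‖φ n y‖ ≤ P y) ∧ ∀ x ∈ S, P x ≠ 0 → ∃ n, φ n x ≠ 0 := by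
  obtain ⟨c, hc, hSc⟩ := hS
  rcases c.eq_empty_or_nonempty with rfl | hne
  · refine ⟨fun _ => 0, fun n y => by simp, fun x hx => ?_⟩
    simpa using hSc hx
  obtain ⟨d, rfl⟩ := hc.exists_eq_range hne
  choose φ hφ hφle using fun n => P.exists_norming_functional (d n)
  refine ⟨φ, hφle, fun x hx hPx => ?_⟩
  have hpos : 0 < P x := lt_of_le_of_ne (apply_nonneg P x) (Ne.symm hPx)
  have hU : {y : E | P (y - x) < P x / 2} ∈ 𝓝 x := by
    have hcont : Continuous fun y => P (y - x) := hP.comp (continuous_id.sub continuous_const)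
    exact hcont.continuousAt.preimage_mem_nhds
      (Iio_mem_nhds (by simpa using half_pos hpos))
  obtain ⟨_, hy, n, rfl⟩ := mem_closure_iff_nhds.1 (hSc hx) _ hU
  -- If `φ n x = 0`, then `P (d n) = ‖φ n (d n - x)‖ < P x / 2`, which is too small for a point so
  -- close to `x`.
  refine ⟨n, fun h0 => ?_⟩
  have h1 : ‖φ n (d n - x)‖ ≤ P (d n - x) := hφle n _
  rw [map_sub, h0, sub_zero, hφ, RCLike.norm_ofReal, abs_of_nonneg (apply_nonneg P _)] at h1
  have h2 : P x ≤ P (d n) + P (d n - x) := by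
    have := map_sub_le_add P (d n) (d n - x)
    simpa using this
  have h3 : P (d n - x) < P x / 2 := hy
  linarith

/-- One integer serves as both index and constant, so a continuity estimate is recorded by a single
number that may be enlarged freely. -/
theorem WithSeminorms.exists_le_nat_mul [TopologicalSpace E] {p : ℕ → Seminorm 𝕜 E}
    (hp : WithSeminorms p) (hmono : Monotone p) {r : Seminorm 𝕜 E} (hr : Continuous r) :
    ∃ m : ℕ, ∀ n ≥ m, ∀ x, r x ≤ n * p n x := by
  obtain ⟨s, C, -, hC⟩ := Seminorm.bound_of_continuous hp r hr
  obtain ⟨N, hN⟩ := exists_nat_ge (C : ℝ)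
  refine ⟨max N (s.sup id), fun n hn x => (hC x).trans ?_⟩
  have hs : s.sup p ≤ p n := Finset.sup_le fun i hi =>
    hmono ((Finset.le_sup (f := id) hi).trans ((le_max_right _ _).trans hn))
  have hn' : (N : ℝ) ≤ n := by exact_mod_cast (le_max_left _ _).trans hn
  calc (C • s.sup p) x = C * s.sup p x := rfl
    _ ≤ n * p n x := mul_le_mul (hN.trans hn') (hs x) (apply_nonneg _ _) (Nat.cast_nonneg _)

theorem WithSeminorms.mem_nhds_iff_of_monotone [TopologicalSpace E] {p : ℕ → Seminorm 𝕜 E}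
    (hp : WithSeminorms p) (hmono : Monotone p) {x : E} {U : Set E} :
    U ∈ 𝓝 x ↔ ∃ l, ∃ ε > 0, ∀ y, p l (y - x) < ε → y ∈ U := by
  rw [hp.mem_nhds_iff]
  constructor
  · rintro ⟨s, ε, hε, hU⟩
    refine ⟨s.sup id, ε, hε, fun y hy => hU ?_⟩
    rw [Seminorm.mem_ball]
    exact lt_of_le_of_lt ((Finset.sup_le fun i hi => hmono (Finset.le_sup (f := id) hi) :
      s.sup p ≤ p (s.sup id)) _) hy
  · rintro ⟨l, ε, hε, hU⟩
    exact ⟨{l}, ε, hε, fun y hy => hU y (by simpa [Seminorm.mem_ball] using hy)⟩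

theorem Seminorm.le_tsum_of_hasSum [TopologicalSpace E] {ι : Type*} {r : Seminorm 𝕜 E}
    (hr : Continuous r) {f : ι → E} {a : E} (hf : HasSum f a) {g : ι → ℝ} (hg : Summable g)
    (hfg : ∀ i, r (f i) ≤ g i) : r a ≤ ∑' i, g i := by
  refine le_of_tendsto ((hr.tendsto a).comp hf) (Eventually.of_forall fun s => ?_)
  calc r (∑ i ∈ s, f i) ≤ ∑ i ∈ s, r (f i) := Finset.le_sum_of_subadditive r (map_zero r).le (map_add_le_add r) s f
    _ ≤ ∑ i ∈ s, g i := Finset.sum_le_sum fun i _ => hfg i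
    _ ≤ ∑' i, g i := hg.sum_le_tsum s fun i _ => (apply_nonneg r _).trans (hfg i)

theorem WithSeminorms.summable_of_summable [UniformSpace E] [IsUniformAddGroup E] [CompleteSpace E]
    {ι : Type*} {p : ℕ → Seminorm 𝕜 E} (hp : WithSeminorms p) (hmono : Monotone p) {f : ι → E}
    (hf : ∀ l, Summable fun i => p l (f i)) : Summable f := by
  rw [summable_iff_vanishing]
  intro U hU
  obtain ⟨l, ε, hε, hlU⟩ := (hp.mem_nhds_iff_of_monotone hmono).1 hU
  obtain ⟨s, hs⟩ := summable_iff_vanishing_norm.1 (hf l) ε hε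
  refine ⟨s, fun t ht => hlU _ ?_⟩
  rw [sub_zero]
  exact lt_of_le_of_lt (Finset.le_sum_of_subadditive (p l) (map_zero _).le (map_add_le_add _) t f) ((le_abs_self _).trans_lt (hs t ht))

/-- A perturbation of the identity that is small for a continuous norm and bounded by it is a closed
embedding. -/
theorem WithSeminorms.isClosedEmbedding_id_add [UniformSpace E] [IsUniformAddGroup E]
    [CompleteSpace E] [T2Space E] {p : ℕ → Seminorm 𝕜 E} (hp : WithSeminorms p)
    {P : Seminorm 𝕜 E} (hP : Continuous P) (hP0 : ∀ x, P x = 0 → x = 0) (K : E →ₗ[𝕜] E)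
    (hK : ∀ x, P (K x) ≤ 1 / 2 * P x) (hKp : ∀ l, ∃ C : NNReal, ∀ x, p l (K x) ≤ C * P x) :
    IsClosedEmbedding (LinearMap.id + K : E →ₗ[𝕜] E) := by
  set R : E →ₗ[𝕜] E := LinearMap.id + K with hRdef
  have hR : ∀ x, R x = x + K x := fun x => rfl
  have hlow : ∀ x, P x ≤ 2 * P (R x) := fun x => by
    have h1 := map_sub_le_add P (R x) (K x)
    rw [hR, add_sub_cancel_right] at h1
    have h2 := hK x
    rw [hR]; linarith
  have hbd : ∀ l (c : NNReal), ∃ s : Finset ℕ, ∃ C' : NNReal, p l + c • P ≤ C' • s.sup p := by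
    intro l c
    have hc : Continuous (p l + c • P) :=
      (hp.continuous_seminorm l).add (hP.const_smul c)
    obtain ⟨s, C', -, h⟩ := Seminorm.bound_of_continuous hp _ hc
    exact ⟨s, C', h⟩
  -- The seminorms pulled back by `R` generate the original topology: `K` costs at most `C * P x`,
  -- and `P x ≤ 2 * P (R x)` turns this into a bound in terms of `R x`.
  have hws : WithSeminorms (SeminormFamily.comp p R) := by
    refine hp.congr (fun l => ?_) fun l => ?_
    · obtain ⟨C, hC⟩ := hKp l
      obtain ⟨s, C', h⟩ := hbd l C
      refine ⟨s, C', le_trans (fun x => ?_) h⟩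
      change p l (R x) ≤ p l x + C * P x
      rw [hR]
      exact (map_add_le_add _ _ _).trans (add_le_add_right (hC x) _)
    · obtain ⟨C, hC⟩ := hKp l
      obtain ⟨s, C', h⟩ := hbd l (2 * C)
      refine ⟨s, C', fun x => ?_⟩
      have h1 : p l x ≤ p l (R x) + C * P x := by
        have := map_sub_le_add (p l) (R x) (K x)
        rw [hR, add_sub_cancel_right] at this
        rw [hR]; linarith [hC x]
      have h2 : p l (R x) + (2 * C) * P (R x) ≤ C' * s.sup p (R x) := h (R x)
      have h3 : (C : ℝ) * P x ≤ C * (2 * P (R x)) :=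
        mul_le_mul_of_nonneg_left (hlow x) C.coe_nonneg
      have h4 : (s.sup (SeminormFamily.comp p R)) x = s.sup p (R x) := by
        rw [← SeminormFamily.finset_sup_comp]; rfl
      change p l x ≤ C' * (s.sup (SeminormFamily.comp p R)) x
      rw [h4]; linarith
  have hind : IsInducing R :=
    ⟨hws.topology_eq_withSeminorms.trans (WithSeminorms.topology_eq_withSeminorms
      (topology := .induced R inferInstance) (R.withSeminorms_induced hp)).symm⟩
  have hinj : Function.Injective R := by
    refine (injective_iff_map_eq_zero R).2 fun x hx => hP0 x (le_antisymm ?_ (apply_nonneg _ _))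
    simpa [hx] using hlow x
  have hemb : IsUniformEmbedding R :=
    ⟨AddMonoidHom.isUniformInducing_of_isInducing hind, hinj⟩
  exact hemb.isClosedEmbedding

theorem Module.exists_linearIndependent_nat_of_not_finite {K V : Type*} [DivisionRing K]
    [AddCommGroup V] [Module K V] (h : ¬ FiniteDimensional K V) :
    ∃ u : ℕ → V, LinearIndependent K u := by
  let b := Module.Basis.ofVectorSpace K V
  have hinf : Infinite (Module.Basis.ofVectorSpaceIndex K V) := by
    by_contra hfin
    rw [not_infinite_iff_finite] at hfin
    exact h (Module.Finite.of_basis b)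
  exact ⟨b ∘ Infinite.natEmbedding _,
    b.linearIndependent.comp _ (Infinite.natEmbedding _).injective⟩

/-- A closed infinite-dimensional subspace contains a separable one. -/
theorem Submodule.exists_le_isClosed_isSeparable [TopologicalSpace E] [IsTopologicalAddGroup E]
    [ContinuousSMul 𝕜 E] {M₀ : Submodule 𝕜 E} (hcl : IsClosed (M₀ : Set E))
    (hinf : ¬ FiniteDimensional 𝕜 M₀) :
    ∃ M ≤ M₀, IsClosed (M : Set E) ∧ ¬ FiniteDimensional 𝕜 M ∧
      TopologicalSpace.IsSeparable (M : Set E) := by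
  obtain ⟨u, hu⟩ := Module.exists_linearIndependent_nat_of_not_finite hinf
  set v : ℕ → E := fun n => u n with hv
  have hvli : LinearIndependent 𝕜 v := hu.map' M₀.subtype M₀.ker_subtype
  have hvM : ∀ n, v n ∈ (Submodule.span 𝕜 (Set.range v)).topologicalClosure := fun n =>
    Submodule.le_topologicalClosure _ (Submodule.subset_span ⟨n, rfl⟩)
  refine ⟨(Submodule.span 𝕜 (Set.range v)).topologicalClosure, ?_,
    Submodule.isClosed_topologicalClosure _, fun hfin => ?_, ?_⟩
  · refine Submodule.topologicalClosure_minimal _ (Submodule.span_le.2 ?_) hcl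
    rintro _ ⟨n, rfl⟩
    exact (u n).2
  · have hli : LinearIndependent 𝕜 fun n =>
        (⟨v n, hvM n⟩ : (Submodule.span 𝕜 (Set.range v)).topologicalClosure) :=
      LinearIndependent.of_comp (Submodule.subtype _) hvli
    exact not_finite_iff_infinite.2 inferInstance hli.finite
  · rw [Submodule.topologicalClosure_coe]
    exact ((Set.countable_range v).isSeparable.span (R := 𝕜)).closure

end Seminorms

/-! ### Inductive construction of the vectors `z t`. -/

section Construction

variable {𝕜 X Y Λ : Type*} [RCLike 𝕜] [AddCommGroup X] [Module 𝕜 X] [AddCommGroup Y] [Module 𝕜 Y]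

/-- One stage of the construction: the vectors with index below `s` are moved into the set of
vectors whose images tend to `0` uniformly on `A`, and a vector of index `s` is added whose orbits
approach `y`. -/
theorem exists_next_approximation (p : ℕ → Seminorm 𝕜 X) (r : Seminorm 𝕜 Y)
    (T : ℕ → Λ → X →ₗ[𝕜] Y) (A : Set Λ)
    (hequi : ∀ K, ∃ m : ℕ, ∀ n ≥ m, ∀ k ∈ Set.Icc 1 K, ∀ lam ∈ A, ∀ v,
      r (T k lam v) ≤ n * p n v)
    (hdense : ∀ x l, ∀ ε : ℝ, 0 < ε → ∃ x', p l (x' - x) < ε ∧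
      ∀ δ : ℝ, 0 < δ → ∃ K, ∀ k ≥ K, ∀ lam ∈ A, r (T k lam x') < δ)
    (happrox : ∀ l, ∀ ε : ℝ, 0 < ε → ∀ y K₀, ∃ x, ∃ K₁ ≥ K₀, p l x < ε ∧
      ∀ lam ∈ A, ∃ k ∈ Set.Icc K₀ K₁, r (T k lam x - y) < ε)
    (s : ℕ) (y : Y) (Z : ℕ → X) (m : ℕ) (hZ : ∀ t ≥ s, Z t = 0) :
    ∃ (Z' : ℕ → X) (m' : ℕ), (∀ t ≥ s + 1, Z' t = 0) ∧ m ≤ m' ∧ s + 1 ≤ m' ∧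
      (∀ t, m * p m (Z' t - Z t) ≤ (1 / 2) ^ (s + t + 3)) ∧
      ∀ lam ∈ A, ∃ k ≥ s, r (T k lam (Z' s) - y) ≤ (1 / 2) ^ s ∧
        (∀ t ≠ s, r (T k lam (Z' t)) ≤ (1 / 2) ^ (s + t)) ∧
        ∀ v, r (T k lam v) ≤ m' * p m' v := by
  -- The denominator `m + 1` keeps the threshold meaningful when `m = 0`.
  have hc : ∀ t, (0 : ℝ) < (1 / 2) ^ (s + t + 3) / (m + 1) := fun t => by positivity
  have hsmall : ∀ t v, p m v < (1 / 2) ^ (s + t + 3) / (m + 1) →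
      m * p m v ≤ (1 / 2) ^ (s + t + 3) := fun t v hv => by
    rw [lt_div_iff₀ (by positivity)] at hv
    nlinarith [apply_nonneg (p m) v]
  choose w hw hwK using fun t => hdense (Z t) m _ (hc t)
  choose N hN using fun t => hwK t ((1 / 2) ^ (s + t)) (by positivity)
  -- The window starts once the images of all `w t`, `t < s`, have become small, and after time `0`,
  -- where no equicontinuity is available.
  obtain ⟨x, K₁, -, hx, hxK⟩ := happrox m (min ((1 / 2) ^ (s + s + 3) / (m + 1)) ((1 / 2) ^ s))
    (lt_min (hc s) (by positivity)) y (max (s + 1) ((Finset.range s).sup N))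
  -- `K₁` does not depend on `lam`, so one integer controls all operators in the window.
  obtain ⟨m₁, hm₁⟩ := hequi K₁
  obtain ⟨Z', hlt, heq, hgt⟩ : ∃ Z' : ℕ → X, (∀ t < s, Z' t = w t) ∧ Z' s = x ∧
      ∀ t > s, Z' t = 0 :=
    ⟨fun t => if t < s then w t else if t = s then x else 0, fun t ht => if_pos ht, by simp,
      fun t ht => by simp [ht.not_gt, ht.ne']⟩
  refine ⟨Z', max m (max (s + 1) m₁),
    fun t ht => hgt t ht, le_max_left _ _, (le_max_left _ _).trans (le_max_right _ _), fun t => ?_,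
    fun lam hlam => ?_⟩
  · apply hsmall
    rcases lt_trichotomy t s with h | rfl | h
    · rw [hlt t h]; exact hw t
    · rw [heq, hZ _ le_rfl, sub_zero]
      exact hx.trans_le (min_le_left _ _)
    · rw [hgt t h, hZ _ h.le, sub_zero, map_zero]
      exact hc t
  · obtain ⟨k, hk, hkr⟩ := hxK lam hlam
    have hks : s + 1 ≤ k := (le_max_left _ _).trans hk.1
    refine ⟨k, by lia, ?_, fun t ht => ?_, fun v =>
      hm₁ _ ((le_max_right _ _).trans (le_max_right _ _)) k ⟨by lia, hk.2⟩ lam hlam v⟩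
    · rw [heq]
      exact (hkr.trans_le (min_le_right _ _)).le
    · rcases lt_or_gt_of_ne ht with h | h
      · rw [hlt t h]
        exact (hN t k ((Finset.le_sup (f := N) (Finset.mem_range.2 h)).trans
          ((le_max_right _ _).trans hk.1)) lam hlam).le
      · rw [hgt t h, map_zero, map_zero]
        positivity

/-- A sequence with geometrically small increments converges, with the corresponding tail
estimates. -/
theorem exists_limit_of_geometric [UniformSpace X] [IsUniformAddGroup X] [CompleteSpace X]
    {p : ℕ → Seminorm 𝕜 X} (hp : WithSeminorms p) (hmono : Monotone p) {m : ℕ → ℕ}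
    (hm : Monotone m) (hm1 : ∀ s, 1 ≤ m s) (hms : ∀ s, s ≤ m s) {u : ℕ → X} {c : ℝ}
    (hu : ∀ i, m i * p (m i) (u (i + 1) - u i) ≤ c * (1 / 2) ^ i) :
    ∃ z, ∀ s, m s * p (m s) (z - u s) ≤ 2 * c * (1 / 2) ^ s := by
  have hle : ∀ s i, s ≤ i → ∀ v, m s * p (m s) v ≤ m i * p (m i) v := fun s i hsi v =>
    mul_le_mul (by exact_mod_cast hm hsi) (hmono (hm hsi) v) (apply_nonneg _ _) (Nat.cast_nonneg _)
  have hone : ∀ s v, p (m s) v ≤ m s * p (m s) v := fun s v =>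
    le_mul_of_one_le_left (apply_nonneg _ _) (by exact_mod_cast hm1 s)
  have hsum : Summable fun i => u (i + 1) - u i := by
    refine hp.summable_of_summable hmono fun l => ?_
    refine Summable.of_norm_bounded_eventually_nat (g := fun i => c * (1 / 2) ^ i)
      (summable_geometric_two.mul_left c) ?_
    filter_upwards [eventually_ge_atTop l] with i hi
    rw [Real.norm_of_nonneg (apply_nonneg _ _)]
    exact (hmono (hi.trans (hms i)) _).trans ((hone i _).trans (hu i))
  have hlim : Tendsto u atTop (𝓝 (∑' i, (u (i + 1) - u i) + u 0)) := by
    have := hsum.hasSum.tendsto_sum_nat.add_const (u 0)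
    simpa only [Finset.sum_range_sub, sub_add_cancel] using this
  refine ⟨∑' i, (u (i + 1) - u i) + u 0, fun s => ?_⟩
  -- The right side is the exact geometric sum of the increments from `s` to `s + j - 1`, so the
  -- induction closes.
  have hfin : ∀ j, m s * p (m s) (u (s + j) - u s) ≤
      2 * c * (1 / 2) ^ s * (1 - (1 / 2) ^ j) := by
    intro j
    induction j with
    | zero => simp
    | succ j ih =>
      have h1 := map_add_le_add (p (m s)) (u (s + (j + 1)) - u (s + j)) (u (s + j) - u s)
      rw [sub_add_sub_cancel] at h1
      have h2 := (hle s (s + j) (by lia) _).trans (hu (s + j))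
      have h3 := mul_le_mul_of_nonneg_left h1 (Nat.cast_nonneg (α := ℝ) (m s))
      rw [mul_add] at h3
      rw [pow_add] at h2
      rw [pow_succ]
      rw [← add_assoc] at h3 ⊢
      linarith
  have hc : 0 ≤ c := by
    have := (mul_nonneg (Nat.cast_nonneg (α := ℝ) (m 0)) (apply_nonneg (p (m 0)) _)).trans (hu 0)
    simpa using this
  have hcont : Continuous fun v => m s * p (m s) (v - u s) :=
    continuous_const.mul ((hp.continuous_seminorm _).comp (continuous_id.sub continuous_const))
  refine le_of_tendsto ((hcont.tendsto _).comp hlim) ?_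
  filter_upwards [eventually_ge_atTop s] with n hn
  obtain ⟨j, rfl⟩ := Nat.exists_eq_add_of_le hn
  refine (hfin j).trans (mul_le_of_le_one_right (by positivity) ?_)
  linarith [show (0 : ℝ) ≤ (1 / 2) ^ j by positivity]

/-- The vectors from which the hypercyclic subspace is built. For every `s` and `lam ∈ A s` some
operator maps `z s` close to `y s` and all the other `z t` close to `0`. -/
theorem exists_seq_approximating [UniformSpace X] [IsUniformAddGroup X] [CompleteSpace X]
    {p : ℕ → Seminorm 𝕜 X} (hp : WithSeminorms p) (hmono : Monotone p) (q : ℕ → Seminorm 𝕜 Y)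
    (T : ℕ → Λ → X →ₗ[𝕜] Y) (A : ℕ → Set Λ)
    (hequi : ∀ s K, ∃ m : ℕ, ∀ n ≥ m, ∀ k ∈ Set.Icc 1 K, ∀ lam ∈ A s, ∀ v,
      q s (T k lam v) ≤ n * p n v)
    (hdense : ∀ s x l, ∀ ε : ℝ, 0 < ε → ∃ x', p l (x' - x) < ε ∧
      ∀ δ : ℝ, 0 < δ → ∃ K, ∀ k ≥ K, ∀ lam ∈ A s, q s (T k lam x') < δ)
    (happrox : ∀ s l, ∀ ε : ℝ, 0 < ε → ∀ y K₀, ∃ x, ∃ K₁ ≥ K₀, p l x < ε ∧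
      ∀ lam ∈ A s, ∃ k ∈ Set.Icc K₀ K₁, q s (T k lam x - y) < ε)
    (y : ℕ → Y) (m₀ : ℕ) (hm₀ : 1 ≤ m₀) :
    ∃ z : ℕ → X, (∀ t, m₀ * p m₀ (z t) ≤ (1 / 2) ^ (t + 2)) ∧
      (∀ l, ∀ t ≥ l, p l (z t) ≤ (1 / 2) ^ (t + 2)) ∧
      ∀ s, ∀ lam ∈ A s, ∃ k ≥ s, q s (T k lam (z s) - y s) ≤ 2 * (1 / 2) ^ s ∧
        ∀ t ≠ s, q s (T k lam (z t)) ≤ 2 * (1 / 2) ^ (s + t) := by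
  choose F G hF hG hG1 hFG hk using fun (s : ℕ) (S : {Z : ℕ → X // ∀ t ≥ s, Z t = 0}) (m : ℕ) =>
    exists_next_approximation p (q s) T (A s) (hequi s) (hdense s) (happrox s) s (y s) S.1 m S.2
  -- The state is the current row of approximations, zero from index `s` on, with the integer that
  -- weighs the next correction.
  let st : ∀ s : ℕ, {Z : ℕ → X // ∀ t ≥ s, Z t = 0} × ℕ := fun s =>
    Nat.rec (motive := fun s => {Z : ℕ → X // ∀ t ≥ s, Z t = 0} × ℕ)
      (⟨fun _ => 0, fun _ _ => rfl⟩, m₀) (fun s S => (⟨F s S.1 S.2, hF s S.1 S.2⟩, G s S.1 S.2)) s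
  set Z : ℕ → ℕ → X := fun s => (st s).1.1 with hZdef
  set m : ℕ → ℕ := fun s => (st s).2 with hmdef
  have hZ : ∀ s, ∀ t ≥ s, Z s t = 0 := fun s => (st s).1.2
  have hm : Monotone m := monotone_nat_of_le_succ fun s => hG s (st s).1 (st s).2
  have hm1 : ∀ s, 1 ≤ m s := fun s => hm₀.trans (hm (Nat.zero_le s))
  have hms : ∀ s, s ≤ m s
    | 0 => Nat.zero_le _
    | s + 1 => hG1 s (st s).1 (st s).2
  have hinc : ∀ s t, m s * p (m s) (Z (s + 1) t - Z s t) ≤ (1 / 2) ^ (s + t + 3) := fun s =>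
    hFG s (st s).1 (st s).2
  have hkey : ∀ s, ∀ lam ∈ A s, ∃ k ≥ s, q s (T k lam (Z (s + 1) s) - y s) ≤ (1 / 2) ^ s ∧
        (∀ t ≠ s, q s (T k lam (Z (s + 1) t)) ≤ (1 / 2) ^ (s + t)) ∧
        ∀ v, q s (T k lam v) ≤ m (s + 1) * p (m (s + 1)) v := fun s =>
    hk s (st s).1 (st s).2
  choose z hz using fun t => exists_limit_of_geometric hp hmono hm hm1 hms
    (u := fun s => Z s t) (c := (1 / 2) ^ (t + 3)) fun i => (hinc i t).trans_eq (by ring)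
  -- Column `t` is still zero at stage `t`, so the tail estimate there bounds `z t` itself.
  have hz0 : ∀ t, m t * p (m t) (z t) ≤ (1 / 2) ^ (t + 2) := fun t => by
    have h := hz t t
    rw [hZ t t le_rfl, sub_zero] at h
    refine h.trans ?_
    have h1 : (1 / 2 : ℝ) ^ t ≤ 1 := pow_le_one₀ (by norm_num) (by norm_num)
    calc 2 * (1 / 2 : ℝ) ^ (t + 3) * (1 / 2) ^ t = (1 / 2) ^ (t + 2) * (1 / 2) ^ t := by ring
      _ ≤ _ := mul_le_of_le_one_right (by positivity) h1
  have hone : ∀ s v, p (m s) v ≤ m s * p (m s) v := fun s v =>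
    le_mul_of_one_le_left (apply_nonneg _ _) (by exact_mod_cast hm1 s)
  refine ⟨z, fun t => le_trans ?_ (hz0 t), fun l t hlt => ?_, fun s lam hlam => ?_⟩
  · have h0t : m₀ ≤ m t := hm (Nat.zero_le t)
    exact mul_le_mul (by exact_mod_cast h0t) (hmono h0t _) (apply_nonneg _ _) (Nat.cast_nonneg _)
  · exact (hmono (hlt.trans (hms t)) _).trans ((hone t _).trans (hz0 t))
  · obtain ⟨k, hks, h1, h2, h3⟩ := hkey s lam hlam
    -- Corrections after stage `s` are measured with `m (s + 1)` or more, which dominates the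
    -- operator chosen at stage `s`.
    have hdiff : ∀ t, q s (T k lam (z t - Z (s + 1) t)) ≤ (1 / 2) ^ (s + t) := fun t => by
      refine (h3 _).trans ((hz t (s + 1)).trans ?_)
      have hpos : (0 : ℝ) ≤ (1 / 2) ^ (s + t) := by positivity
      calc 2 * (1 / 2 : ℝ) ^ (t + 3) * (1 / 2) ^ (s + 1) = 1 / 8 * (1 / 2) ^ (s + t) := by ring
        _ ≤ _ := by linarith
    refine ⟨k, hks, ?_, fun t ht => ?_⟩
    · have h4 := map_add_le_add (q s) (T k lam (z s - Z (s + 1) s)) (T k lam (Z (s + 1) s) - y s)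
      rw [map_sub, sub_add_sub_cancel, ← map_sub] at h4
      have h5 : (1 / 2 : ℝ) ^ (s + s) ≤ (1 / 2) ^ s :=
        pow_le_pow_of_le_one (by norm_num) (by norm_num) (by lia)
      linarith [hdiff s]
    · have h4 := map_add_le_add (q s) (T k lam (z t - Z (s + 1) t)) (T k lam (Z (s + 1) t))
      rw [← map_add, sub_add_cancel] at h4
      linarith [hdiff t, h2 t ht]

end Construction

/-! ### The nuclear perturbation and its image under the operators. -/

section Perturbation

variable {𝕜 X Y Λ : Type*} [RCLike 𝕜] [AddCommGroup X] [Module 𝕜 X] [AddCommGroup Y] [Module 𝕜 Y]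

/-- The exponent `t + 2` is what makes the contraction constant of `K` equal to `1 / 2`. -/
theorem hasSum_geometric_quarter (c : ℝ) :
    HasSum (fun t : ℕ => c * (1 / 2) ^ (t + 2)) (1 / 2 * c) := by
  have h := hasSum_geometric_two.mul_left (c / 4)
  rw [show c / 4 * 2 = 1 / 2 * c by ring] at h
  exact h.congr_fun fun t => by ring

/-- The nuclear operator `x ↦ ∑ t, ψ t x • z t`, for functionals `ψ t` dominated by `P` and a rapidly
decreasing sequence `z`. -/
theorem exists_hasSum_functional_smul [UniformSpace X] [IsUniformAddGroup X] [CompleteSpace X]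
    [T2Space X] {p : ℕ → Seminorm 𝕜 X} (hp : WithSeminorms p) (hmono : Monotone p)
    {P : Seminorm 𝕜 X} (hP : Continuous P) {ψ : ℕ → X →ₗ[𝕜] 𝕜} (hψ : ∀ t x, ‖ψ t x‖ ≤ P x)
    {z : ℕ → X} (hPz : ∀ t, P (z t) ≤ (1 / 2) ^ (t + 2))
    (hpz : ∀ l, ∀ t ≥ l, p l (z t) ≤ (1 / 2) ^ (t + 2)) :
    ∃ K : X →ₗ[𝕜] X, (∀ x, HasSum (fun t => ψ t x • z t) (K x)) ∧
      (∀ x, P (K x) ≤ 1 / 2 * P x) ∧ ∀ l, ∃ C : NNReal, ∀ x, p l (K x) ≤ C * P x := by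
  have := hp.continuousSMul
  have hsz : ∀ l, Summable fun t => p l (z t) := fun l => by
    refine Summable.of_norm_bounded_eventually_nat (g := fun t => 1 * (1 / 2) ^ (t + 2))
      (hasSum_geometric_quarter 1).summable ?_
    filter_upwards [eventually_ge_atTop l] with t ht
    rw [Real.norm_of_nonneg (apply_nonneg _ _), one_mul]
    exact hpz l t ht
  have hle : ∀ (r : Seminorm 𝕜 X) x t, r (ψ t x • z t) ≤ P x * r (z t) := fun r x t => by
    rw [map_smul_eq_mul]
    exact mul_le_mul_of_nonneg_right (hψ t x) (apply_nonneg _ _)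
  have hsum : ∀ x, Summable fun t => ψ t x • z t := fun x =>
    hp.summable_of_summable hmono fun l =>
      Summable.of_nonneg_of_le (fun t => apply_nonneg _ _) (hle (p l) x) ((hsz l).mul_left (P x))
  refine ⟨{ toFun := fun x => ∑' t, ψ t x • z t
            map_add' := fun x y => ?_
            map_smul' := fun c x => ?_ }, fun x => (hsum x).hasSum, fun x => ?_, fun l =>
      ⟨⟨∑' t, p l (z t), tsum_nonneg fun t => apply_nonneg _ _⟩, fun x => ?_⟩⟩
  · simp only [map_add, add_smul]
    exact (hsum x).tsum_add (hsum y)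
  · simp only [map_smul, smul_assoc, RingHom.id_apply]
    exact (hsum x).tsum_const_smul c
  · rw [← (hasSum_geometric_quarter (P x)).tsum_eq]
    exact Seminorm.le_tsum_of_hasSum hP (hsum x).hasSum (hasSum_geometric_quarter (P x)).summable
      fun t => (hle P x t).trans (mul_le_mul_of_nonneg_left (hPz t) (apply_nonneg _ _))
  · refine (Seminorm.le_tsum_of_hasSum (hp.continuous_seminorm l) (hsum x).hasSum
      ((hsz l).mul_left (P x)) (hle (p l) x)).trans_eq ?_
    rw [tsum_mul_left, mul_comm]
    rfl

/-- A sum with coefficients bounded by `B` whose `s`-th term is close to `y`, and whose other terms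
are small, is close to `y`. -/
theorem Seminorm.sub_le_of_hasSum [TopologicalSpace Y] [IsTopologicalAddGroup Y]
    [ContinuousSMul 𝕜 Y] {r : Seminorm 𝕜 Y} (hr : Continuous r) {a : ℕ → 𝕜} {B : ℝ}
    (ha : ∀ t, ‖a t‖ ≤ B) {v : ℕ → Y} {w y : Y} (hw : HasSum (fun t => a t • v t) w) {s : ℕ}
    (hs : r (v s - y) ≤ 2 * (1 / 2) ^ s) (hv : ∀ t ≠ s, r (v t) ≤ 2 * (1 / 2) ^ (s + t)) :
    r (w - a s • y) ≤ 6 * B * (1 / 2) ^ s := by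
  have hB : 0 ≤ B := (norm_nonneg _).trans (ha s)
  have h1 : HasSum (fun t => a t • (if t = s then v s - y else v t)) (w - a s • y) := by
    refine (hw.sub (hasSum_ite_eq s (a s • y))).congr_fun fun t => ?_
    split_ifs with h
    · rw [h, smul_sub]
    · rw [sub_zero]
  -- The geometric part also covers `t = s`, which is harmless; the total is `2 + 4 = 6` times `B *
  -- (1 / 2) ^ s`.
  have hg : HasSum (fun t => B * (if t = s then 2 * (1 / 2) ^ s else 0) +
      B * (2 * (1 / 2) ^ s) * (1 / 2 : ℝ) ^ t) (B * (2 * (1 / 2) ^ s) + B * (2 * (1 / 2) ^ s) * 2) :=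
    ((hasSum_ite_eq s _).mul_left B).add (hasSum_geometric_two.mul_left _)
  refine (r.le_tsum_of_hasSum hr h1 hg.summable fun t => ?_).trans_eq ?_
  · rw [map_smul_eq_mul]
    have h0 : (0 : ℝ) ≤ (1 / 2) ^ s := by positivity
    split_ifs with h
    · have h2 := mul_le_mul (ha t) hs (apply_nonneg _ _) hB
      have h3 : 0 ≤ B * (2 * (1 / 2) ^ s) * (1 / 2 : ℝ) ^ t := by positivity
      linarith
    · have h2 := mul_le_mul (ha t) (hv t h) (apply_nonneg _ _) hB
      rw [pow_add] at h2
      linarith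
  · rw [hg.tsum_eq]; ring

end Perturbation

/-! ### The common hypercyclic subspace. -/

theorem mainTheorem3 {𝕜 X Y Λ : Type*} [RCLike 𝕜]
    [AddCommGroup X] [Module 𝕜 X] [UniformSpace X]
    [AddCommGroup Y] [Module 𝕜 Y] [UniformSpace Y]
    (hX : IsFrechetSpace 𝕜 X) (hXnorm : HasContinuousNorm 𝕜 X)
    (hY : IsFrechetSpace 𝕜 Y) (hYsep : TopologicalSpace.SeparableSpace Y)
    (p : ℕ → Seminorm 𝕜 X) (hp : IsDefiningSequence p)
    (q : ℕ → Seminorm 𝕜 Y) (hq : IsDefiningSequence q)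
    (T : ℕ → Λ → X →L[𝕜] Y)
    (L₀ L₁ L₂ : ℕ → Set Λ) (hL₀ : IsChainOf L₀) (hL₁ : IsChainOf L₁) (hL₂ : IsChainOf L₂)
    (h_i : ∀ k ≥ 1, ∀ n ≥ 1, Equicontinuous fun (lam : L₀ n) (x : X) => T k lam x)
    (h_ii : ∀ n ≥ 1, ∃ D : Set X, Dense D ∧ ∀ x ∈ D,
      TendstoUniformlyOn (fun (k : ℕ) (lam : Λ) => T k lam x) (fun _ => 0) atTop (L₁ n))
    (h_iii : ∀ l ≥ 1, ∀ n ≥ 1, ∀ ε : ℝ, 0 < ε → ∀ y : Y, ∀ K₀ : ℕ,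
      ∃ x : X, ∃ K₁ ≥ K₀, p l x < ε ∧
        ∀ lam ∈ L₂ n, ∃ k ∈ Set.Icc K₀ K₁, q l (T k lam x - y) < ε)
    (h_iv : ∃ M₀ : Submodule 𝕜 X, IsClosed (M₀ : Set X) ∧ ¬ FiniteDimensional 𝕜 M₀ ∧
      ∀ lam : Λ, ∀ x ∈ M₀, Tendsto (fun k : ℕ => T k lam x) atTop (𝓝 0)) :
    HasCommonHypercyclicSubspace T := by
  have := hX.uniformAddGroup
  have := hX.t2
  have := hX.complete
  have := hY.uniformAddGroup
  have := hp.withSeminorms.continuousSMul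
  have := hq.withSeminorms.continuousSMul
  have hmp := hp.monotone
  have hmq := hq.monotone
  replace hp := hp.withSeminorms
  replace hq := hq.withSeminorms
  obtain ⟨P, hP, hP0⟩ := hXnorm
  obtain ⟨M₀, hM₀cl, hM₀inf, hM₀⟩ := h_iv
  obtain ⟨M₁, hM₁le, hM₁cl, hM₁inf, hM₁sep⟩ :=
    Submodule.exists_le_isClosed_isSeparable hM₀cl hM₀inf
  obtain ⟨φ, hφ, hφ0⟩ := Seminorm.exists_seq_functional_ne_zero hP hM₁sep
  have hchain : ∀ {L : ℕ → Set Λ}, IsChainOf L → Monotone fun s => L (s + 1) := fun hL =>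
    monotone_nat_of_le_succ fun s => hL.mono (s + 1) (by lia)
  -- The shift is there because chains start at index `1`. Each `lam` lies in `A s` for all large
  -- `s`.
  set A : ℕ → Set Λ := fun s => L₀ (s + 1) ∩ L₁ (s + 1) ∩ L₂ (s + 1) with hA
  have hAev : ∀ lam, ∃ N, ∀ s ≥ N, lam ∈ A s := fun lam => by
    have hex : ∀ {L : ℕ → Set Λ}, IsChainOf L → ∃ N, ∀ s ≥ N, lam ∈ L (s + 1) := fun hL => by
      obtain ⟨n, hn, hlam⟩ := hL.exhausts lam
      obtain ⟨n, rfl⟩ := Nat.exists_eq_add_of_le' hn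
      exact ⟨n, fun s hs => hchain hL hs hlam⟩
    obtain ⟨N₀, h₀⟩ := hex hL₀
    obtain ⟨N₁, h₁⟩ := hex hL₁
    obtain ⟨N₂, h₂⟩ := hex hL₂
    exact ⟨max N₀ (max N₁ N₂), fun s hs =>
      ⟨⟨h₀ s (by lia), h₁ s (by lia)⟩, h₂ s (by lia)⟩⟩
  have hequi : ∀ s K, ∃ m : ℕ, ∀ n ≥ m, ∀ k ∈ Set.Icc 1 K, ∀ lam ∈ A s, ∀ v,
      q s ((T k lam : X →ₗ[𝕜] Y) v) ≤ n * p n v := fun s K => by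
    have hk : ∀ k, ∃ m : ℕ, 1 ≤ k → ∀ n ≥ m, ∀ lam ∈ A s, ∀ v,
        q s ((T k lam : X →ₗ[𝕜] Y) v) ≤ n * p n v := fun k => by
      rcases Nat.eq_zero_or_pos k with rfl | hk
      · exact ⟨0, fun h => absurd h (by lia)⟩
      have hunif : UniformEquicontinuous
          ((fun f : X →ₗ[𝕜] Y => (f : X → Y)) ∘ fun lam : L₀ (s + 1) => (T k lam : X →ₗ[𝕜] Y)) :=
        ((hq.equicontinuous_TFAE _).out 1 2).1 (h_i k hk (s + 1) (by lia))
      obtain ⟨r, hr, hle⟩ := (hq.uniformEquicontinuous_iff_exists_continuous_seminorm _).1 hunif s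
      obtain ⟨m, hm⟩ := hp.exists_le_nat_mul hmp hr
      exact ⟨m, fun _ n hn lam hlam v => (hle ⟨lam, hlam.1.1⟩ v).trans (hm n hn v)⟩
    choose m hm using hk
    exact ⟨(Finset.Icc 1 K).sup m, fun n hn k hk lam hlam v =>
      hm k hk.1 n ((Finset.le_sup (Finset.mem_Icc.2 hk)).trans hn) lam hlam v⟩
  have hdense : ∀ s x l, ∀ ε : ℝ, 0 < ε → ∃ x', p l (x' - x) < ε ∧ ∀ δ : ℝ, 0 < δ → ∃ K, ∀ k ≥ K,
      ∀ lam ∈ A s, q s ((T k lam : X →ₗ[𝕜] Y) x') < δ := fun s x l ε hε => by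
    obtain ⟨D, hD, hDT⟩ := h_ii (s + 1) (by lia)
    obtain ⟨x', hx', hx'D⟩ := mem_closure_iff_nhds.1 (hD x) {x' | p l (x' - x) < ε}
      ((hp.mem_nhds_iff_of_monotone hmp).2 ⟨l, ε, hε, fun _ h => h⟩)
    refine ⟨x', hx', fun δ hδ => ?_⟩
    have hu : {a : Y × Y | q s (a.2 - a.1) < δ} ∈ uniformity Y := by
      rw [uniformity_eq_comap_nhds_zero]
      refine ⟨{b | q s b < δ}, (hq.mem_nhds_iff_of_monotone hmq).2 ⟨s, δ, hδ, fun b hb => ?_⟩,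
        fun _ h => h⟩
      rwa [sub_zero] at hb
    obtain ⟨K, hK⟩ := eventually_atTop.1 (hDT x' hx'D _ hu)
    refine ⟨K, fun k hk lam hlam => ?_⟩
    have h : q s (T k lam x' - 0) < δ := hK k hk lam hlam.1.2
    rwa [sub_zero] at h
  have happrox : ∀ s l, ∀ ε : ℝ, 0 < ε → ∀ y K₀, ∃ x, ∃ K₁ ≥ K₀, p l x < ε ∧
      ∀ lam ∈ A s, ∃ k ∈ Set.Icc K₀ K₁, q s ((T k lam : X →ₗ[𝕜] Y) x - y) < ε :=
    fun s l ε hε y K₀ => by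
    -- Hypothesis (iii) uses one level for both spaces; this one is at least `l` for `p`, at least
    -- `s` for `q`, and positive.
    obtain ⟨x, K₁, hK, hx, h⟩ := h_iii (max l s + 1) (by lia) (s + 1) (by lia) ε hε y K₀
    refine ⟨x, K₁, hK, (hmp (by lia) x).trans_lt hx, fun lam hlam => ?_⟩
    obtain ⟨k, hk, hkε⟩ := h lam hlam.2
    exact ⟨k, hk, (hmq (by lia) _).trans_lt hkε⟩
  obtain ⟨m₀, hm₀⟩ := hp.exists_le_nat_mul hmp hP
  obtain ⟨d, hd⟩ := TopologicalSpace.exists_dense_seq Y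
  -- An index `s` codes a triple `(n, j, i)`: the functional `φ n`, the target `d j`, and a free `i`
  -- that makes `s` as large as needed.
  obtain ⟨z, hz0, hzp, hzT⟩ := exists_seq_approximating hp hmp q
    (fun k lam => (T k lam : X →ₗ[𝕜] Y)) A hequi hdense happrox
    (fun s => d s.unpair.2.unpair.1) (m₀ + 1) (by lia)
  obtain ⟨K, hKsum, hKP, hKp⟩ := exists_hasSum_functional_smul hp hmp hP
    (ψ := fun t => φ t.unpair.1) (fun t => hφ _)
    (fun t => (hm₀ _ (Nat.le_succ m₀) (z t)).trans (hz0 t)) hzp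
  have hemb := hp.isClosedEmbedding_id_add hP hP0 K hKP hKp
  refine ⟨M₁.map (LinearMap.id + K), ?_, fun hfin => hM₁inf ?_, ?_⟩
  · rw [Submodule.map_coe]
    exact hemb.isClosedMap _ hM₁cl
  · exact Module.Finite.equiv (Submodule.equivMapOfInjective _ hemb.injective M₁).symm
  rintro _ ⟨v, hv, rfl⟩ hne lam y
  have hPv : P v ≠ 0 := fun h => hne (by rw [hP0 v h, map_zero])
  obtain ⟨n, hn⟩ := hφ0 v hv hPv
  rw [mem_closure_iff_nhds]
  intro U hU
  obtain ⟨l, ε, hε, hlU⟩ := (hq.mem_nhds_iff_of_monotone hmq).1 hU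
  obtain ⟨N₁, hN₁⟩ := hAev lam
  have hTv : ∀ᶠ k in atTop, q l (T k lam v) < ε / 3 := by
    have h := ((hq.continuous_seminorm l).tendsto 0).comp (hM₀ lam v (hM₁le hv))
    rw [map_zero] at h
    exact h.eventually (gt_mem_nhds (by positivity))
  obtain ⟨N₂, hN₂⟩ := eventually_atTop.1 hTv
  have hpow : ∀ᶠ s : ℕ in atTop, 6 * P v * (1 / 2) ^ s < ε / 3 := by
    have h := (tendsto_pow_atTop_nhds_zero_of_lt_one (r := (1 / 2 : ℝ)) (by norm_num)
      (by norm_num)).const_mul (6 * P v)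
    rw [mul_zero] at h
    exact h.eventually (gt_mem_nhds (by positivity))
  obtain ⟨N₃, hN₃⟩ := eventually_atTop.1 hpow
  -- The coefficient of `z s` in `K v` is `φ n v`, so the target must approximate `(φ n v)⁻¹ • y`.
  obtain ⟨j, hj⟩ : ∃ j, q l (φ n v • d j - y) < ε / 3 := by
    have hc : Continuous fun b => q l (φ n v • b - y) :=
      (hq.continuous_seminorm l).comp ((continuous_const_smul _).sub continuous_const)
    have ho : IsOpen {b | q l (φ n v • b - y) < ε / 3} := isOpen_lt hc continuous_const
    obtain ⟨j, hb⟩ := hd.exists_mem_open ho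
      ⟨(φ n v)⁻¹ • y, by simp [smul_inv_smul₀ hn, hε]⟩
    exact ⟨j, hb⟩
  set i := max (max N₁ N₂) (max N₃ l) with hi
  set s := Nat.pair n (Nat.pair j i) with hs
  have his : i ≤ s := (Nat.right_le_pair _ _).trans (Nat.right_le_pair _ _)
  obtain ⟨k, hks, hk1, hk2⟩ := hzT s lam (hN₁ s (by lia))
  refine ⟨_, hlU _ ?_, k, rfl⟩
  have hsum : HasSum (fun t : ℕ => φ t.unpair.1 v • T k lam (z t)) (T k lam (K v)) := by
    simpa [Function.comp_def] using (hKsum v).mapL (T k lam)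
  have h1 := Seminorm.sub_le_of_hasSum (hq.continuous_seminorm s) (a := fun t => φ t.unpair.1 v)
    (fun t => hφ _ v) hsum hk1 hk2
  simp only [hs, Nat.unpair_pair] at h1
  rw [← hs] at h1
  have h2 := hmq (show l ≤ s by lia) (T k lam (K v) - φ n v • d j)
  have h3 := hN₂ k (by lia)
  have h4 := hN₃ s (by lia)
  have hsplit : T k lam ((LinearMap.id + K : X →ₗ[𝕜] X) v) - y =
      T k lam v + ((T k lam (K v) - φ n v • d j) + (φ n v • d j - y)) := by
    rw [LinearMap.add_apply, LinearMap.id_apply, map_add]; abel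
  rw [hsplit]
  have h5 := map_add_le_add (q l) (T k lam v) ((T k lam (K v) - φ n v • d j) + (φ n v • d j - y))
  have h6 := map_add_le_add (q l) (T k lam (K v) - φ n v • d j) (φ n v • d j - y)
  linarith
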